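/- Let $(H,\rho)$ be a complete $\mathrm{CAT}(0)$ space with the geodesic extension property, i.e. for every $L>0$ every unit speed geodesic $[0,L]\to H$ is the restriction of an isometric embedding $\mathbb{R}\to H$. For $p,q\in H$ let $\gamma_{p,q}:[0,1]\to H$ be the unique geodesic with constant speed $\rho(p,q)$ from $p$ to $q$; a subset of $H$ is convex if it contains the image of $\gamma_{x,y}$ for all points $x,y$ in it. For a geodesic $\gamma:[0,1]\to H$ of constant speed put $\zeta(\gamma)=0$ if $\gamma$ is constant and $\zeta(\gamma)=1$ otherwise. For two such geodesics $\gamma_1,\gamma_2$ issuing from $p$ let $\angle_p(\gamma_1,\gamma_2)=\lim_{s,t\to0^+}\overline{\angle}_p(\gamma_1(s),\gamma_2(t))$ be their Alexandrov angle, where $\overline{\angle}_p(q,r)$ is the Euclidean comparison angle at $p$ if $q,r\neq p$, equals $\pi/2$ if exactly one of $q,r$ is $p$, and equals $0$ if $q=r=p$. Let $S_p$ be the set of constant-speed geodesics $[0,1]\to H$ issuing from $p$, with geodesics at angle $0$ identified. The tangent space $T_pH$ is the quotient of $[0,\infty)\times S_p$ (the class of $(t,\gamma)$ is written $t\gamma$)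 in which $t_1\gamma_1=t_2\gamma_2$ if and only if either $t_1\zeta(\gamma_1)=t_2\zeta(\gamma_2)=0$, or $t_1\zeta(\gamma_1)=t_2\zeta(\gamma_2)>0$ and $\gamma_1=\gamma_2$ in $S_p$. It carries the metric $$d_p(t_1\gamma_1,t_2\gamma_2)=\sqrt{t_1^2\zeta(\gamma_1)+t_2^2\zeta(\gamma_2)-2t_1t_2\zeta(\gamma_1)\zeta(\gamma_2)\cos\angle_p(\gamma_1,\gamma_2)}.$$ Put $0_p=0\gamma_{p,p}$, $\|\eta\|_p=d_p(0_p,\eta)$, and $g_p(\eta,\eta')=\tfrac12\left(\|\eta\|_p^2+\|\eta'\|_p^2-d_p(\eta,\eta')^2\right)$. Let $A$ be a set-valued vector field on $H$, i.e. $Ap\subseteq T_pH$ for every $p\in H$, and let $\operatorname{dom}A=\{p\in H: Ap\neq\emptyset\}$. Suppose that $A$ is monotone, i.e. $g_p(\eta,\gamma_{p,q})\le -g_q(\nu,\gamma_{q,p})$ for all $p,q\in H$, $\eta\in Ap$, $\nu\in Aq$, and that $A$ satisfies the surjectivity condition: for all $t>0$ and $x\in H$ there is $p\in H$ with $t\rho(p,x)\gamma_{p,x}\in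 Ap$. Then $\overline{\operatorname{dom}A}$ is convex. Moreover, for all $\lambda>0$ and $x\in H$ there is exactly one point $J_\lambda x\in H$ with $\lambda^{-1}\rho(J_\lambda x,x)\,\gamma_{J_\lambda x,x}\in A(J_\lambda x)$, and $$\overline{\operatorname{dom}A}=\left\{x\in H:\ \lim_{\lambda\to0^+}J_\lambda x=x\right\}.$$ -/

import Mathlib

open Set Filter Topology
open scoped NNReal

noncomputable section

namespace HadamardSpace

/-- `c`, restricted to `[0,1]`, is a normalized geodesic: `d(c(s),c(t)) = K |s - t|` on `[0,1]`, where
the constant `K` is necessarily `d(c(0),c(1))`. Values of `c` outside `[0,1]` play no role. -/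
def IsNormalizedGeodesic {X : Type*} [MetricSpace X] (c : ℝ → X) : Prop :=
  ∀ s ∈ Icc (0 : ℝ) 1, ∀ t ∈ Icc (0 : ℝ) 1, dist (c s) (c t) = dist (c 0) (c 1) * |s - t|

/-- A `CAT(0)` space: a geodesic metric space in which any two points `u = c i s`, `v = c j t` of any
geodesic triangle (with sides `c 0`, `c 1`, `c 2`, traversed cyclically) are at most as far apart as
their comparison points in any Euclidean comparison triangle (with vertices `P 0`, `P 1`, `P 2`). -/
class CAT0Space (X : Type*) [MetricSpace X] : Prop where
  exists_geodesic : ∀ x y : X, ∃ c : ℝ → X, IsNormalizedGeodesic c ∧ c 0 = x ∧ c 1 = y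
  dist_le_comparison : ∀ (c : Fin 3 → ℝ → X) (P : Fin 3 → EuclideanSpace ℝ (Fin 2)),
    (∀ i, IsNormalizedGeodesic (c i)) → (∀ i, c i 1 = c (i + 1) 0) →
    (∀ i, dist (P i) (P (i + 1)) = dist (c i 0) (c i 1)) →
    ∀ (i j : Fin 3), ∀ s ∈ Icc (0 : ℝ) 1, ∀ t ∈ Icc (0 : ℝ) 1,
      dist (c i s) (c j t) ≤
        dist (AffineMap.lineMap (P i) (P (i + 1)) s) (AffineMap.lineMap (P j) (P (j + 1)) t)

/-- The geodesic extension property: every (nondegenerate) unit speed geodesic `[0,L] → X` extends to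
an isometric embedding of the real line. -/
def GeodesicExtensionProperty (X : Type*) [MetricSpace X] : Prop :=
  ∀ (L : ℝ) (c : ℝ → X), 0 < L →
    (∀ s ∈ Icc (0 : ℝ) L, ∀ t ∈ Icc (0 : ℝ) L, dist (c s) (c t) = |s - t|) →
    ∃ e : ℝ → X, Isometry e ∧ ∀ t ∈ Icc (0 : ℝ) L, e t = c t

/-- `C` is convex: it contains the geodesic segment between any two of its points. -/
def GeodesicallyConvex {X : Type*} [MetricSpace X] (C : Set X) : Prop :=
  ∀ c : ℝ → X, IsNormalizedGeodesic c → c 0 ∈ C → c 1 ∈ C → ∀ t ∈ Icc (0 : ℝ) 1, c t ∈ C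

/-- The normalized geodesics issuing from `p`. -/
def GeodesicFrom {X : Type*} [MetricSpace X] (p : X) : Type _ :=
  {c : ℝ → X // IsNormalizedGeodesic c ∧ c 0 = p}

/-- The (unique) normalized geodesic `γ_{p,q}` joining `p` to `q`. -/
def geod {X : Type*} [MetricSpace X] [CAT0Space X] (p q : X) : GeodesicFrom p :=
  ⟨Classical.choose (CAT0Space.exists_geodesic p q),
    (Classical.choose_spec (CAT0Space.exists_geodesic p q)).1,
    (Classical.choose_spec (CAT0Space.exists_geodesic p q)).2.1⟩

open Classical in
/-- The comparison angle at `p` between `q` and `r`. For `q, r ≠ p` it is the angle at the vertex `p` of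
a Euclidean comparison triangle, written with the law of cosines. -/
def comparisonAngle {X : Type*} [MetricSpace X] (p q r : X) : ℝ :=
  if q = p ∧ r = p then 0
  else if q = p ∨ r = p then Real.pi / 2
  else Real.arccos
    ((dist p q ^ 2 + dist p r ^ 2 - dist q r ^ 2) / (2 * (dist p q * dist p r)))

/-- The Alexandrov angle `lim_{s,t → 0⁺}` of the comparison angles between `γ₁(s)` and `γ₂(t)`. -/
def alexandrovAngle {X : Type*} [MetricSpace X] {p : X} (c₁ c₂ : GeodesicFrom p) : ℝ :=
  limUnder (𝓝[>] (0 : ℝ) ×ˢ 𝓝[>] (0 : ℝ))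
    (fun x : ℝ × ℝ => comparisonAngle p (c₁.1 x.1) (c₂.1 x.2))

open Classical in
/-- The zero geodesic indicator: `0` if the geodesic is constant and `1` otherwise. -/
def GeodesicFrom.zeta {X : Type*} [MetricSpace X] {p : X} (c : GeodesicFrom p) : ℝ≥0 :=
  if c.1 1 = p then 0 else 1

section Angles

/-! The Alexandrov angle exists in a `CAT(0)` space, and it is compatible with the identification of
geodesics at angle `0`. -/

variable {X : Type*} [MetricSpace X] {p : X}

theorem GeodesicFrom.dist_base (c : GeodesicFrom p) {s : ℝ} (hs : s ∈ Icc (0 : ℝ) 1) :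
    dist p (c.1 s) = dist p (c.1 1) * s := by
  have h := c.2.1 0 ⟨le_rfl, zero_le_one⟩ s hs
  rw [c.2.2] at h
  rw [h, zero_sub, abs_neg, abs_of_nonneg hs.1]

theorem GeodesicFrom.eq_base (c : GeodesicFrom p) (hc : c.1 1 = p) {s : ℝ}
    (hs : s ∈ Icc (0 : ℝ) 1) : c.1 s = p := by
  have h := c.dist_base hs
  rw [hc, dist_self, zero_mul, dist_eq_zero] at h
  exact h.symm

theorem GeodesicFrom.ne_base (c : GeodesicFrom p) (hc : c.1 1 ≠ p) {s : ℝ}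
    (hs : s ∈ Ioc (0 : ℝ) 1) : c.1 s ≠ p := by
  intro h
  have h' := c.dist_base (Ioc_subset_Icc_self hs)
  rw [h, dist_self] at h'
  have : 0 < dist p (c.1 1) * s := mul_pos (dist_pos.2 hc.symm) hs.1
  linarith

theorem eventually_Ioc : ∀ᶠ s in 𝓝[>] (0 : ℝ), s ∈ Ioc (0 : ℝ) 1 :=
  Ioc_mem_nhdsGT zero_lt_one

theorem comparisonAngle_comm (p q r : X) : comparisonAngle p q r = comparisonAngle p r q := by
  unfold comparisonAngle
  rw [dist_comm q r, add_comm (dist p q ^ 2), mul_comm (dist p q)]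
  by_cases hq : q = p <;> by_cases hr : r = p <;> simp [hq, hr]

theorem comparisonAngle_mem (p q r : X) : comparisonAngle p q r ∈ Icc 0 Real.pi := by
  unfold comparisonAngle
  have := Real.pi_pos
  split_ifs
  · exact ⟨le_rfl, this.le⟩
  · constructor <;> linarith
  · exact ⟨Real.arccos_nonneg _, Real.arccos_le_pi _⟩

theorem cos_comparisonAngle {p q r : X} (hq : q ≠ p) (hr : r ≠ p) :
    Real.cos (comparisonAngle p q r) =
      (dist p q ^ 2 + dist p r ^ 2 - dist q r ^ 2) / (2 * (dist p q * dist p r)) := by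
  unfold comparisonAngle
  rw [if_neg (by tauto), if_neg (by tauto)]
  have h1 : 0 < dist p q := dist_pos.2 hq.symm
  have h2 : 0 < dist p r := dist_pos.2 hr.symm
  have h3 := dist_triangle_left q r p
  have h4 := dist_triangle p q r
  have h5 := dist_triangle p r q
  rw [dist_comm r q] at h5
  have h6 : 0 ≤ dist q r := dist_nonneg
  apply Real.cos_arccos
  · rw [le_div_iff₀ (by positivity)]
    nlinarith
  · rw [div_le_one (by positivity)]
    nlinarith

/-- Euclidean comparison triangles exist. -/
theorem exists_comparison_triangle {p q : X} (hq : q ≠ p) (r : X) :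
    ∃ x y : ℝ, x ^ 2 + y ^ 2 = dist p r ^ 2 ∧ (dist p q - x) ^ 2 + y ^ 2 = dist q r ^ 2 := by
  have h1 : 0 < dist p q := dist_pos.2 hq.symm
  have h3 := dist_triangle_left q r p
  have h4 := dist_triangle p q r
  have h5 := dist_triangle p r q
  rw [dist_comm r q] at h5
  have h6 : 0 ≤ dist q r := dist_nonneg
  have h7 : 0 ≤ dist p r := dist_nonneg
  set x : ℝ := (dist p q ^ 2 + dist p r ^ 2 - dist q r ^ 2) / (2 * dist p q) with hx
  have hx' : 2 * dist p q * x = dist p q ^ 2 + dist p r ^ 2 - dist q r ^ 2 := by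
    rw [hx]; field_simp
  have hle : x ^ 2 ≤ dist p r ^ 2 := by
    apply sq_le_sq'
    · have : 0 ≤ 2 * dist p q * (x + dist p r) := by nlinarith
      have := nonneg_of_mul_nonneg_right this (by positivity)
      linarith
    · have : 0 ≤ 2 * dist p q * (dist p r - x) := by nlinarith
      have := nonneg_of_mul_nonneg_right this (by positivity)
      linarith
  refine ⟨x, Real.sqrt (dist p r ^ 2 - x ^ 2), ?_, ?_⟩ <;>
    rw [Real.sq_sqrt (by linarith)] <;> nlinarith

theorem cat0_two_sides [CAT0Space X] (c₁ c₂ : GeodesicFrom p) {s t a b : ℝ}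
    (hs : s ∈ Ioc (0 : ℝ) 1) (ht : t ∈ Ioc (0 : ℝ) 1) (ha : a ∈ Icc (0 : ℝ) 1)
    (hb : b ∈ Icc (0 : ℝ) 1) (h1 : c₁.1 1 ≠ p) :
    dist (c₁.1 (s * a)) (c₂.1 (t * b)) ^ 2 ≤ a ^ 2 * dist p (c₁.1 s) ^ 2
      + b ^ 2 * dist p (c₂.1 t) ^ 2
      - a * b * (dist p (c₁.1 s) ^ 2 + dist p (c₂.1 t) ^ 2 - dist (c₁.1 s) (c₂.1 t) ^ 2) := by
  obtain ⟨x, y, hxy, hxy'⟩ := exists_comparison_triangle (c₁.ne_base h1 hs) (c₂.1 t)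
  obtain ⟨e, he, he0, he1⟩ := CAT0Space.exists_geodesic (c₁.1 s) (c₂.1 t)
  have key := CAT0Space.dist_le_comparison
    ![fun u => c₁.1 (s * u), e, fun u => c₂.1 (t * (1 - u))]
    ![!₂[0, 0], !₂[dist p (c₁.1 s), 0], !₂[x, y]] ?_ ?_ ?_ 0 2 a ha (1 - b)
      ⟨by linarith [hb.2], by linarith [hb.1]⟩
  · have hk := pow_le_pow_left₀ dist_nonneg key 2
    rw [EuclideanSpace.dist_eq, Real.sq_sqrt (by positivity)] at hk
    simp [AffineMap.lineMap_apply, Real.dist_eq, sq_abs] at hk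
    rw [← hxy, ← hxy']
    linarith
  · intro i
    fin_cases i
    · intro u hu v hv
      have e1 := c₁.2.1 (s * u) ⟨mul_nonneg hs.1.le hu.1, mul_le_one₀ hs.2 hu.1 hu.2⟩ (s * v)
        ⟨mul_nonneg hs.1.le hv.1, mul_le_one₀ hs.2 hv.1 hv.2⟩
      have e2 := c₁.dist_base (Ioc_subset_Icc_self hs)
      simp only [Fin.zero_eta, Matrix.cons_val_zero, mul_zero, mul_one, c₁.2.2] at e1 ⊢
      rw [e1, e2, ← mul_sub, abs_mul, abs_of_pos hs.1, mul_assoc]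
    · exact he
    · intro u hu v hv
      have e1 := c₂.2.1 (t * (1 - u)) ⟨mul_nonneg ht.1.le (by linarith [hu.2]),
        mul_le_one₀ ht.2 (by linarith [hu.2]) (by linarith [hu.1])⟩ (t * (1 - v))
        ⟨mul_nonneg ht.1.le (by linarith [hv.2]),
        mul_le_one₀ ht.2 (by linarith [hv.2]) (by linarith [hv.1])⟩
      have e2 := c₂.dist_base (Ioc_subset_Icc_self ht)
      have e3 : t * (1 - u) - t * (1 - v) = t * (v - u) := by ring
      simp only [Fin.reduceFinMk, Matrix.cons_val, sub_zero, sub_self, mul_zero, mul_one,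
        c₂.2.2] at e1 ⊢
      rw [e1, dist_comm _ p, e2, e3, abs_mul, abs_of_pos ht.1, abs_sub_comm, mul_assoc]
  · intro i
    fin_cases i
    · simp [he0]
    · simp [he1]
    · simp [c₁.2.2, c₂.2.2]
  · intro i
    fin_cases i
    · simp [EuclideanSpace.dist_eq, c₁.2.2, Real.dist_eq]
    · simp [EuclideanSpace.dist_eq, he0, he1, Real.dist_eq, hxy']
    · simp [EuclideanSpace.dist_eq, c₂.2.2, Real.dist_eq, hxy, dist_comm]

theorem comparisonAngle_mono [CAT0Space X] (c₁ c₂ : GeodesicFrom p) (h1 : c₁.1 1 ≠ p)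
    (h2 : c₂.1 1 ≠ p) {s t s' t' : ℝ} (hs' : 0 < s') (hss : s' ≤ s) (hs : s ≤ 1) (ht' : 0 < t')
    (htt : t' ≤ t) (ht : t ≤ 1) :
    comparisonAngle p (c₁.1 s') (c₂.1 t') ≤ comparisonAngle p (c₁.1 s) (c₂.1 t) := by
  have hs0 : s ∈ Ioc (0 : ℝ) 1 := ⟨hs'.trans_le hss, hs⟩
  have ht0 : t ∈ Ioc (0 : ℝ) 1 := ⟨ht'.trans_le htt, ht⟩
  have hs0' : s' ∈ Ioc (0 : ℝ) 1 := ⟨hs', hss.trans hs⟩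
  have ht0' : t' ∈ Ioc (0 : ℝ) 1 := ⟨ht', htt.trans ht⟩
  rw [← Real.strictAntiOn_cos.le_iff_ge (comparisonAngle_mem _ _ _) (comparisonAngle_mem _ _ _),
    cos_comparisonAngle (c₁.ne_base h1 hs0) (c₂.ne_base h2 ht0),
    cos_comparisonAngle (c₁.ne_base h1 hs0') (c₂.ne_base h2 ht0')]
  have hp1 : 0 < s := hs0.1
  have hp2 : 0 < t := ht0.1
  have key := cat0_two_sides c₁ c₂ (a := s' / s) (b := t' / t) hs0 ht0
    ⟨by positivity, (div_le_one hs0.1).2 hss⟩ ⟨by positivity, (div_le_one ht0.1).2 htt⟩ h1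
  rw [mul_div_cancel₀ _ hs0.1.ne', mul_div_cancel₀ _ ht0.1.ne'] at key
  have hl1 : 0 < dist p (c₁.1 1) := dist_pos.2 h1.symm
  have hl2 : 0 < dist p (c₂.1 1) := dist_pos.2 h2.symm
  have e1 := c₁.dist_base (Ioc_subset_Icc_self hs0)
  have e2 := c₂.dist_base (Ioc_subset_Icc_self ht0)
  have e1' := c₁.dist_base (Ioc_subset_Icc_self hs0')
  have e2' := c₂.dist_base (Ioc_subset_Icc_self ht0')
  rw [e1, e2] at key ⊢
  rw [e1', e2']
  set l₁ := dist p (c₁.1 1)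
  set l₂ := dist p (c₂.1 1)
  set d := dist (c₁.1 s) (c₂.1 t) ^ 2
  set d' := dist (c₁.1 s') (c₂.1 t') ^ 2
  have hA : ((l₁ * s) ^ 2 + (l₂ * t) ^ 2 - d) / (2 * (l₁ * s * (l₂ * t))) =
      (s' / s * (t' / t) * ((l₁ * s) ^ 2 + (l₂ * t) ^ 2 - d)) / (2 * (l₁ * s' * (l₂ * t'))) := by
    field_simp
  rw [hA]
  apply div_le_div_of_nonneg_right _ (by positivity)
  have hB : (s' / s) ^ 2 * (l₁ * s) ^ 2 = (l₁ * s') ^ 2 := by field_simp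
  have hC : (t' / t) ^ 2 * (l₂ * t) ^ 2 = (l₂ * t') ^ 2 := by field_simp
  rw [hB, hC] at key
  linarith

theorem eventually_prod_Ioc : ∀ᶠ x in 𝓝[>] (0 : ℝ) ×ˢ 𝓝[>] (0 : ℝ),
    x.1 ∈ Ioc (0 : ℝ) 1 ∧ x.2 ∈ Ioc (0 : ℝ) 1 :=
  eventually_Ioc.prod_mk eventually_Ioc

/-- The limit which defines the Alexandrov angle exists. -/
theorem tendsto_alexandrovAngle [CAT0Space X] (c₁ c₂ : GeodesicFrom p) :
    Tendsto (fun x : ℝ × ℝ => comparisonAngle p (c₁.1 x.1) (c₂.1 x.2))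
      (𝓝[>] (0 : ℝ) ×ˢ 𝓝[>] (0 : ℝ)) (𝓝 (alexandrovAngle c₁ c₂)) := by
  apply tendsto_nhds_limUnder
  by_cases h1 : c₁.1 1 = p
  · by_cases h2 : c₂.1 1 = p
    · refine ⟨0, tendsto_const_nhds.congr' ?_⟩
      filter_upwards [eventually_prod_Ioc] with x hx
      rw [c₁.eq_base h1 (Ioc_subset_Icc_self hx.1), c₂.eq_base h2 (Ioc_subset_Icc_self hx.2)]
      simp [comparisonAngle]
    · refine ⟨Real.pi / 2, tendsto_const_nhds.congr' ?_⟩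
      filter_upwards [eventually_prod_Ioc] with x hx
      have := c₂.ne_base h2 hx.2
      rw [c₁.eq_base h1 (Ioc_subset_Icc_self hx.1)]
      simp [comparisonAngle, this]
  · by_cases h2 : c₂.1 1 = p
    · refine ⟨Real.pi / 2, tendsto_const_nhds.congr' ?_⟩
      filter_upwards [eventually_prod_Ioc] with x hx
      have := c₁.ne_base h1 hx.1
      rw [c₂.eq_base h2 (Ioc_subset_Icc_self hx.2)]
      simp [comparisonAngle, this]
    · set f : ℝ × ℝ → ℝ := fun x => comparisonAngle p (c₁.1 x.1) (c₂.1 x.2) with hf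
      set S : Set (ℝ × ℝ) := Ioc (0 : ℝ) 1 ×ˢ Ioc (0 : ℝ) 1
      have hbdd : BddBelow (f '' S) :=
        ⟨0, by rintro _ ⟨x, -, rfl⟩; exact (comparisonAngle_mem _ _ _).1⟩
      have hne : (f '' S).Nonempty := ⟨_, (1, 1), by simp [S], rfl⟩
      refine ⟨sInf (f '' S), tendsto_order.2 ⟨fun a ha => ?_, fun a ha => ?_⟩⟩
      · filter_upwards [eventually_prod_Ioc] with x hx
        exact ha.trans_le (csInf_le hbdd ⟨x, ⟨hx.1, hx.2⟩, rfl⟩)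
      · obtain ⟨_, ⟨y, hy, rfl⟩, hya⟩ := exists_lt_of_csInf_lt hne ha
        have e1 : ∀ᶠ s in 𝓝[>] (0 : ℝ), s ∈ Ioc (0 : ℝ) y.1 := Ioc_mem_nhdsGT hy.1.1
        have e2 : ∀ᶠ s in 𝓝[>] (0 : ℝ), s ∈ Ioc (0 : ℝ) y.2 := Ioc_mem_nhdsGT hy.2.1
        filter_upwards [e1.prod_mk e2] with x hx
        exact (comparisonAngle_mono c₁ c₂ h1 h2 hx.1.1 hx.1.2 hy.1.2 hx.2.1 hx.2.2 hy.2.2).trans_lt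
          hya

theorem alexandrovAngle_mem [CAT0Space X] (c₁ c₂ : GeodesicFrom p) :
    alexandrovAngle c₁ c₂ ∈ Icc 0 Real.pi :=
  isClosed_Icc.mem_of_tendsto (tendsto_alexandrovAngle c₁ c₂)
    (Eventually.of_forall fun _ => comparisonAngle_mem _ _ _)

theorem alexandrovAngle_comm [CAT0Space X] (c₁ c₂ : GeodesicFrom p) :
    alexandrovAngle c₁ c₂ = alexandrovAngle c₂ c₁ := by
  refine tendsto_nhds_unique (tendsto_alexandrovAngle c₁ c₂) ?_
  refine ((tendsto_alexandrovAngle c₂ c₁).comp tendsto_prod_swap).congr fun x => ?_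
  exact comparisonAngle_comm _ _ _

theorem alexandrovAngle_self [CAT0Space X] (c : GeodesicFrom p) : alexandrovAngle c c = 0 := by
  have h : Tendsto (fun s : ℝ => (s, s)) (𝓝[>] (0 : ℝ)) (𝓝[>] (0 : ℝ) ×ˢ 𝓝[>] (0 : ℝ)) :=
    tendsto_id.prodMk tendsto_id
  refine tendsto_nhds_unique ((tendsto_alexandrovAngle c c).comp h)
    (tendsto_const_nhds.congr fun s => ?_)
  simp only [Function.comp, comparisonAngle]
  by_cases hs : c.1 s = p
  · simp [hs]
  · have : 0 < dist p (c.1 s) := dist_pos.2 (Ne.symm hs)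
    have e : (dist p (c.1 s) ^ 2 + dist p (c.1 s) ^ 2 - dist (c.1 s) (c.1 s) ^ 2) /
        (2 * (dist p (c.1 s) * dist p (c.1 s))) = 1 := by
      rw [dist_self]; field_simp; ring
    rw [e]
    simp [hs]

/-- The angle between a zero geodesic and a nonzero one is `π / 2`. -/
theorem alexandrovAngle_of_zero [CAT0Space X] (c₁ c₂ : GeodesicFrom p) (h1 : c₁.1 1 = p)
    (h2 : c₂.1 1 ≠ p) : alexandrovAngle c₁ c₂ = Real.pi / 2 := by
  refine tendsto_nhds_unique (tendsto_alexandrovAngle c₁ c₂) (tendsto_const_nhds.congr' ?_)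
  filter_upwards [eventually_prod_Ioc] with x hx
  have := c₂.ne_base h2 hx.2
  rw [c₁.eq_base h1 (Ioc_subset_Icc_self hx.1)]
  simp [comparisonAngle, this]

theorem alexandrovAngle_zero_zero [CAT0Space X] (c₁ c₂ : GeodesicFrom p) (h1 : c₁.1 1 = p)
    (h2 : c₂.1 1 = p) : alexandrovAngle c₁ c₂ = 0 := by
  refine tendsto_nhds_unique (tendsto_alexandrovAngle c₁ c₂) (tendsto_const_nhds.congr' ?_)
  filter_upwards [eventually_prod_Ioc] with x hx
  rw [c₁.eq_base h1 (Ioc_subset_Icc_self hx.1), c₂.eq_base h2 (Ioc_subset_Icc_self hx.2)]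
  simp [comparisonAngle]

theorem zero_iff_of_angle_eq_zero [CAT0Space X] {c₁ c₂ : GeodesicFrom p}
    (h : alexandrovAngle c₁ c₂ = 0) : c₁.1 1 = p ↔ c₂.1 1 = p := by
  have hpi := Real.pi_pos
  constructor
  · intro h1
    by_contra h2
    rw [alexandrovAngle_of_zero c₁ c₂ h1 h2] at h
    linarith
  · intro h1
    by_contra h2
    rw [alexandrovAngle_comm, alexandrovAngle_of_zero c₂ c₁ h1 h2] at h
    linarith

/-- For nonzero geodesics the angle can be computed with points at equal distance from `p`. -/
theorem tendsto_cos_angle [CAT0Space X] (c₁ c₂ : GeodesicFrom p) (h1 : c₁.1 1 ≠ p)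
    (h2 : c₂.1 1 ≠ p) :
    Tendsto (fun r : ℝ => 1 - (dist (c₁.1 (r / dist p (c₁.1 1)))
      (c₂.1 (r / dist p (c₂.1 1))) / r) ^ 2 / 2) (𝓝[>] 0) (𝓝 (Real.cos (alexandrovAngle c₁ c₂))) := by
  have hl1 : 0 < dist p (c₁.1 1) := dist_pos.2 h1.symm
  have hl2 : 0 < dist p (c₂.1 1) := dist_pos.2 h2.symm
  have hdiv : ∀ l : ℝ, 0 < l → Tendsto (fun r : ℝ => r / l) (𝓝[>] 0) (𝓝[>] 0) := by
    intro l hl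
    refine tendsto_nhdsWithin_iff.2 ⟨?_, ?_⟩
    · have : Tendsto (fun r : ℝ => r / l) (𝓝 0) (𝓝 (0 / l)) := tendsto_id.div_const l
      rw [zero_div] at this
      exact this.mono_left nhdsWithin_le_nhds
    · filter_upwards [self_mem_nhdsWithin] with r hr
      exact div_pos hr hl
  have hT := (tendsto_alexandrovAngle c₁ c₂).comp ((hdiv _ hl1).prodMk (hdiv _ hl2))
  refine ((Real.continuous_cos.tendsto _).comp hT).congr' ?_
  filter_upwards [self_mem_nhdsWithin, (hdiv _ hl1).eventually eventually_Ioc,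
    (hdiv _ hl2).eventually eventually_Ioc] with r hr hr1 hr2
  have hr0 : 0 < r := hr
  simp only [Function.comp]
  rw [cos_comparisonAngle (c₁.ne_base h1 hr1) (c₂.ne_base h2 hr2),
    c₁.dist_base (Ioc_subset_Icc_self hr1), c₂.dist_base (Ioc_subset_Icc_self hr2),
    mul_div_cancel₀ _ hl1.ne', mul_div_cancel₀ _ hl2.ne']
  field_simp
  ring

/-- Geodesics at angle `0` form the same angles with every third geodesic. -/
theorem alexandrovAngle_congr [CAT0Space X] {c₁ c₂ : GeodesicFrom p}
    (h : alexandrovAngle c₁ c₂ = 0) (c₃ : GeodesicFrom p) :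
    alexandrovAngle c₁ c₃ = alexandrovAngle c₂ c₃ := by
  have hiff := zero_iff_of_angle_eq_zero h
  by_cases h1 : c₁.1 1 = p
  · have h2 := hiff.1 h1
    by_cases h3 : c₃.1 1 = p
    · rw [alexandrovAngle_zero_zero _ _ h1 h3, alexandrovAngle_zero_zero _ _ h2 h3]
    · rw [alexandrovAngle_of_zero _ _ h1 h3, alexandrovAngle_of_zero _ _ h2 h3]
  have h2 : c₂.1 1 ≠ p := fun h' => h1 (hiff.2 h')
  by_cases h3 : c₃.1 1 = p
  · rw [alexandrovAngle_comm c₁, alexandrovAngle_comm c₂, alexandrovAngle_of_zero _ _ h3 h1,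
      alexandrovAngle_of_zero _ _ h3 h2]
  apply Real.injOn_cos (alexandrovAngle_mem _ _) (alexandrovAngle_mem _ _)
  have T12 := tendsto_cos_angle c₁ c₂ h1 h2
  have T13 := tendsto_cos_angle c₁ c₃ h1 h3
  have T23 := tendsto_cos_angle c₂ c₃ h2 h3
  rw [h, Real.cos_zero] at T12
  have hl1 : 0 < dist p (c₁.1 1) := dist_pos.2 (Ne.symm h1)
  have hl2 : 0 < dist p (c₂.1 1) := dist_pos.2 h2.symm
  have hl3 : 0 < dist p (c₃.1 1) := dist_pos.2 (Ne.symm h3)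
  set P₁ : ℝ → X := fun r => c₁.1 (r / dist p (c₁.1 1)) with hP₁
  set P₂ : ℝ → X := fun r => c₂.1 (r / dist p (c₂.1 1)) with hP₂
  set P₃ : ℝ → X := fun r => c₃.1 (r / dist p (c₃.1 1)) with hP₃
  have D12 : Tendsto (fun r => dist (P₁ r) (P₂ r) / r) (𝓝[>] 0) (𝓝 0) := by
    have h' : Tendsto (fun r => (dist (P₁ r) (P₂ r) / r) ^ 2) (𝓝[>] 0) (𝓝 0) := by
      have := (T12.const_sub 1).mul_const 2
      simp only [sub_self, zero_mul] at this
      exact this.congr fun r => by ring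
    have h'' := (Real.continuous_sqrt.tendsto 0).comp h'
    rw [Real.sqrt_zero] at h''
    refine h''.congr' ?_
    filter_upwards [self_mem_nhdsWithin] with r hr
    exact Real.sqrt_sq (div_nonneg dist_nonneg (le_of_lt hr))
  have hball : ∀ c : GeodesicFrom p, 0 < dist p (c.1 1) →
      ∀ᶠ r in 𝓝[>] (0 : ℝ), dist p (c.1 (r / dist p (c.1 1))) = r := by
    intro c hc
    filter_upwards [Ioc_mem_nhdsGT hc] with r hr
    rw [c.dist_base ⟨div_nonneg hr.1.le hc.le, (div_le_one hc).2 hr.2⟩, mul_div_cancel₀ _ hc.ne']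
  have hdiff := T13.sub T23
  have hzero : Tendsto (fun r : ℝ => (1 - (dist (P₁ r) (P₃ r) / r) ^ 2 / 2) -
      (1 - (dist (P₂ r) (P₃ r) / r) ^ 2 / 2)) (𝓝[>] 0) (𝓝 0) := by
    refine squeeze_zero_norm' (a := fun r => 2 * (dist (P₁ r) (P₂ r) / r)) ?_
      (by simpa using D12.const_mul 2)
    filter_upwards [self_mem_nhdsWithin, hball c₁ hl1, hball c₂ hl2, hball c₃ hl3]
      with r hr e1 e2 e3
    have hr0 : 0 < r := hr
    have t1 : dist (P₁ r) (P₃ r) ≤ 2 * r := by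
      have := dist_triangle_left (P₁ r) (P₃ r) p
      simp only [hP₁, hP₃] at this ⊢
      linarith
    have t2 : dist (P₂ r) (P₃ r) ≤ 2 * r := by
      have := dist_triangle_left (P₂ r) (P₃ r) p
      simp only [hP₂, hP₃] at this ⊢
      linarith
    have t3 : |dist (P₁ r) (P₃ r) - dist (P₂ r) (P₃ r)| ≤ dist (P₁ r) (P₂ r) :=
      abs_dist_sub_le _ _ _
    have n1 : 0 ≤ dist (P₁ r) (P₃ r) := dist_nonneg
    have n2 : 0 ≤ dist (P₂ r) (P₃ r) := dist_nonneg
    have id1 : (1 - (dist (P₁ r) (P₃ r) / r) ^ 2 / 2) - (1 - (dist (P₂ r) (P₃ r) / r) ^ 2 / 2) =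
        -((dist (P₁ r) (P₃ r) - dist (P₂ r) (P₃ r)) / r *
          ((dist (P₁ r) (P₃ r) + dist (P₂ r) (P₃ r)) / r)) / 2 := by
      field_simp; ring
    rw [id1, Real.norm_eq_abs, abs_div, abs_neg, abs_mul, abs_div, abs_div, abs_of_pos hr0,
      abs_of_nonneg (add_nonneg n1 n2), abs_of_pos (two_pos : (0 : ℝ) < 2)]
    have q1 : (dist (P₁ r) (P₃ r) + dist (P₂ r) (P₃ r)) / r ≤ 4 := by
      rw [div_le_iff₀ hr0]; linarith
    have q2 : |dist (P₁ r) (P₃ r) - dist (P₂ r) (P₃ r)| / r ≤ dist (P₁ r) (P₂ r) / r :=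
      div_le_div_of_nonneg_right t3 hr0.le
    have q3 : 0 ≤ dist (P₁ r) (P₂ r) / r := div_nonneg dist_nonneg hr0.le
    have q4 := mul_le_mul q2 q1 (by positivity) q3
    linarith
  have := tendsto_nhds_unique hdiff hzero
  linarith

theorem GeodesicFrom.zeta_congr [CAT0Space X] {c₁ c₂ : GeodesicFrom p}
    (h : alexandrovAngle c₁ c₂ = 0) : c₁.zeta = c₂.zeta := by
  have := zero_iff_of_angle_eq_zero h
  unfold GeodesicFrom.zeta
  by_cases h1 : c₁.1 1 = p
  · rw [if_pos h1, if_pos (this.1 h1)]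
  · rw [if_neg h1, if_neg fun h2 => h1 (this.2 h2)]

end Angles

/-- Normalized geodesics issuing from `p` are identified when their Alexandrov angle is `0`. -/
def directionSetoid {H : Type*} [MetricSpace H] [CAT0Space H] (p : H) : Setoid (GeodesicFrom p) where
  r c₁ c₂ := alexandrovAngle c₁ c₂ = 0
  iseqv :=
    { refl := alexandrovAngle_self
      symm := fun h => (alexandrovAngle_comm _ _).trans h
      trans := fun h h' => (alexandrovAngle_congr h _).trans h' }

/-- The space of directions `S_p` at `p`. -/
def Direction {H : Type*} [MetricSpace H] [CAT0Space H] (p : H) : Type _ :=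
  Quotient (directionSetoid p)

/-- The direction at `p` of the geodesic `γ_{p,q}`. -/
def Direction.to {H : Type*} [MetricSpace H] [CAT0Space H] (p q : H) : Direction p :=
  Quotient.mk (directionSetoid p) (geod p q)

/-- The zero geodesic indicator on `S_p`. -/
def Direction.zeta {H : Type*} [MetricSpace H] [CAT0Space H] {p : H} : Direction p → ℝ≥0 :=
  Quotient.lift GeodesicFrom.zeta fun _ _ h => GeodesicFrom.zeta_congr h

/-- The Alexandrov angle on `S_p`. -/
def Direction.angle {H : Type*} [MetricSpace H] [CAT0Space H] {p : H} :
    Direction p → Direction p → ℝ :=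
  Quotient.lift₂ alexandrovAngle fun _ b₁ a₂ b₂ h h' =>
    (alexandrovAngle_congr h b₁).trans
      ((alexandrovAngle_comm a₂ b₁).trans
        ((alexandrovAngle_congr h' a₂).trans (alexandrovAngle_comm b₂ a₂)))

/-- The relation on `[0,∞) × S_p` that defines the tangent space. -/
def tangentSetoid {H : Type*} [MetricSpace H] [CAT0Space H] (p : H) :
    Setoid (ℝ≥0 × Direction p) where
  r x y := (x.1 * x.2.zeta = 0 ∧ y.1 * y.2.zeta = 0) ∨
    (x.1 * x.2.zeta = y.1 * y.2.zeta ∧ 0 < x.1 * x.2.zeta ∧ x.2 = y.2)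
  iseqv :=
    { refl := fun x => by
        rcases eq_or_ne (x.1 * x.2.zeta) 0 with h | h
        · exact Or.inl ⟨h, h⟩
        · exact Or.inr ⟨rfl, pos_iff_ne_zero.2 h, rfl⟩
      symm := by
        rintro x y (⟨h, h'⟩ | ⟨h, h', h''⟩)
        · exact Or.inl ⟨h', h⟩
        · exact Or.inr ⟨h.symm, h ▸ h', h''.symm⟩
      trans := by
        rintro x y z (⟨h, h'⟩ | ⟨h, h', h''⟩) (⟨k, k'⟩ | ⟨k, k', k''⟩)
        · exact Or.inl ⟨h, k'⟩
        · exact absurd h' k'.ne'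
        · exact absurd (h.trans k) h'.ne'
        · exact Or.inr ⟨h.trans k, h', h''.trans k''⟩ }

/-- The tangent space `T_pH` of `H` at `p`. -/
def TangentCone {H : Type*} [MetricSpace H] [CAT0Space H] (p : H) : Type _ :=
  Quotient (tangentSetoid p)

/-- The class `tγ` of `(t, γ)` in `T_pH`. -/
def TangentCone.mk {H : Type*} [MetricSpace H] [CAT0Space H] {p : H} (t : ℝ≥0) (u : Direction p) :
    TangentCone p :=
  Quotient.mk (tangentSetoid p) (t, u)

/-- The origin `0_p` of `T_pH`. -/
def TangentCone.zero {H : Type*} [MetricSpace H] [CAT0Space H] (p : H) : TangentCone p :=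
  TangentCone.mk 0 (Direction.to p p)

/-- The vector `t ρ(p,x) γ_{p,x}` of `T_pH`. -/
def TangentCone.scaled {H : Type*} [MetricSpace H] [CAT0Space H] (t : ℝ≥0) (p x : H) :
    TangentCone p :=
  TangentCone.mk (t * nndist p x) (Direction.to p x)

/-- The formula for the metric of `T_pH` on representatives. -/
def coneDist {H : Type*} [MetricSpace H] [CAT0Space H] {p : H} (x y : ℝ≥0 × Direction p) : ℝ :=
  Real.sqrt ((x.1 : ℝ) ^ 2 * x.2.zeta + (y.1 : ℝ) ^ 2 * y.2.zeta
    - 2 * x.1 * y.1 * x.2.zeta * y.2.zeta * Real.cos (x.2.angle y.2))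

theorem Direction.zeta_eq {H : Type*} [MetricSpace H] [CAT0Space H] {p : H} (u : Direction p) :
    u.zeta = 0 ∨ u.zeta = 1 := by
  induction u using Quotient.inductionOn with
  | h c =>
    change c.zeta = 0 ∨ c.zeta = 1
    unfold GeodesicFrom.zeta
    split_ifs <;> simp

theorem coneDist_eq {H : Type*} [MetricSpace H] [CAT0Space H] {p : H} (x y : ℝ≥0 × Direction p) :
    coneDist x y = Real.sqrt (((x.1 * x.2.zeta : ℝ≥0) : ℝ) ^ 2 + ((y.1 * y.2.zeta : ℝ≥0) : ℝ) ^ 2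
      - 2 * (x.1 * x.2.zeta : ℝ≥0) * (y.1 * y.2.zeta : ℝ≥0) * Real.cos (x.2.angle y.2)) := by
  unfold coneDist
  congr 1
  push_cast
  rcases x.2.zeta_eq with h | h <;> rcases y.2.zeta_eq with k | k <;> rw [h, k] <;> simp

theorem coneDist_congr {H : Type*} [MetricSpace H] [CAT0Space H] {p : H}
    (a₁ b₁ a₂ b₂ : ℝ≥0 × Direction p) (h : (tangentSetoid p).r a₁ a₂)
    (k : (tangentSetoid p).r b₁ b₂) : coneDist a₁ b₁ = coneDist a₂ b₂ := by
  rw [coneDist_eq, coneDist_eq]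
  rcases h with ⟨h, h'⟩ | ⟨h, -, h'⟩ <;> rcases k with ⟨k, k'⟩ | ⟨k, -, k'⟩
  · rw [h, h', k, k']; simp
  · rw [h, h', k]; simp
  · rw [h, k, k']; simp
  · rw [h, k, h', k']

/-- The metric `d_p` of `T_pH`. -/
def TangentCone.tdist {H : Type*} [MetricSpace H] [CAT0Space H] {p : H} :
    TangentCone p → TangentCone p → ℝ :=
  Quotient.lift₂ coneDist coneDist_congr

/-- `‖η‖_p = d_p(0_p, η)`. -/
def TangentCone.tnorm {H : Type*} [MetricSpace H] [CAT0Space H] {p : H} (v : TangentCone p) : ℝ :=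
  TangentCone.tdist (TangentCone.zero p) v

/-- The product `g_p` on `T_pH`. -/
def TangentCone.prod {H : Type*} [MetricSpace H] [CAT0Space H] {p : H} (v w : TangentCone p) : ℝ :=
  (1 / 2 : ℝ) * (v.tnorm ^ 2 + w.tnorm ^ 2 - v.tdist w ^ 2)

/-- A set-valued vector field on `H`. -/
abbrev VectorField (H : Type*) [MetricSpace H] [CAT0Space H] : Type _ :=
  ∀ p : H, Set (TangentCone p)

/-- The domain of a vector field. -/
def VectorField.dom {H : Type*} [MetricSpace H] [CAT0Space H] (A : VectorField H) : Set H :=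
  {p | (A p).Nonempty}

/-- Monotonicity: `g_p(η, γ_{p,q}) ≤ - g_q(ν, γ_{q,p})` for all `η ∈ Ap`, `ν ∈ Aq`. -/
def VectorField.Monotone {H : Type*} [MetricSpace H] [CAT0Space H] (A : VectorField H) : Prop :=
  ∀ p q : H, ∀ v ∈ A p, ∀ w ∈ A q,
    TangentCone.prod v (TangentCone.mk 1 (Direction.to p q)) ≤
      -TangentCone.prod w (TangentCone.mk 1 (Direction.to q p))

/-- The surjectivity condition: for all `t > 0` and `x` there is `p` with `t ρ(p,x) γ_{p,x} ∈ Ap`. -/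
def VectorField.SurjectivityCondition {H : Type*} [MetricSpace H] [CAT0Space H]
    (A : VectorField H) : Prop :=
  ∀ (t : ℝ≥0) (x : H), 0 < t → ∃ p : H, TangentCone.scaled t p x ∈ A p

/-- The (set-valued) resolvent `J_r x = {z | r⁻¹ ρ(z,x) γ_{z,x} ∈ Az}`, for `r > 0`. -/
def VectorField.resolvent {H : Type*} [MetricSpace H] [CAT0Space H] (A : VectorField H) (r : ℝ≥0)
    (x : H) : Set H :=
  {z | TangentCone.scaled r⁻¹ z x ∈ A z}

end HadamardSpace

end

namespace HadamardSpace

variable {H : Type*} [MetricSpace H] [CAT0Space H]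

/-! Everything rests on two inequalities. In a CAT(0) space the Alexandrov angle is at most the
comparison angle, so the law of cosines becomes a lower bound for `g_p` on vectors pointing towards
given points (`le_prod_scaled`). Monotonicity supplies the matching upper bound.

Together they give uniqueness of resolvent points, and for `w` in the domain the estimate `dist (J r
z) w ≤ dist z w + O(r)`. By density, `limsup dist (J r z) x ≤ dist z x` as `r → 0`, for all `z` and
all `x` in the closure of the domain. With `z = x` this says `J r x → x`; conversely a limit of
resolvent points lies in the closure, since resolvent points lie in the domain.

For convexity take `z = c t` on a geodesic whose endpoints lie in the closure. Asymptotically `J r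
z` is no farther from either endpoint than `z` is, and the CAT(0) inequality `dist_sq_geodesic_le`
leaves room only for `J r z → z`. -/

theorem geod_one (p q : H) : (geod p q).1 1 = q :=
  (Classical.choose_spec (CAT0Space.exists_geodesic p q)).2.2

theorem Direction.zeta_to {p q : H} (h : q ≠ p) : (Direction.to p q).zeta = 1 :=
  if_neg (by rwa [geod_one])

theorem Direction.zeta_le_one {p : H} (u : Direction p) : (u.zeta : ℝ) ≤ 1 := by
  rcases u.zeta_eq with h | h <;> simp [h]

/-! ### The product `g_p` and its CAT(0) bounds -/

/-- `d_p` is the metric of a Euclidean cone in which `tγ` has radius `tζ(γ)`, as `ζ` takes only the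
values 0 and 1. Polarizing the law of cosines leaves the product of the radii and the cosine. -/
theorem TangentCone.prod_mk {p : H} (s t : ℝ≥0) (u v : Direction p) :
    (TangentCone.mk s u).prod (TangentCone.mk t v) =
      (s * u.zeta : ℝ≥0) * (t * v.zeta : ℝ≥0) * Real.cos (u.angle v) := by
  have hzero : ∀ (r : ℝ≥0) (w : Direction p), (TangentCone.mk r w).tnorm ^ 2 =
      ((r * w.zeta : ℝ≥0) : ℝ) ^ 2 := by
    intro r w
    change coneDist (0, Direction.to p p) (r, w) ^ 2 = _
    rw [coneDist_eq, Real.sq_sqrt] <;> simp [sq_nonneg]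
  have hdist : (TangentCone.mk s u).tdist (TangentCone.mk t v) ^ 2 =
      ((s * u.zeta : ℝ≥0) : ℝ) ^ 2 + ((t * v.zeta : ℝ≥0) : ℝ) ^ 2
        - 2 * (s * u.zeta : ℝ≥0) * (t * v.zeta : ℝ≥0) * Real.cos (u.angle v) := by
    change coneDist (s, u) (t, v) ^ 2 = _
    rw [coneDist_eq, Real.sq_sqrt]
    -- The radicand is nonnegative: since the cosine is at most 1, it dominates the square of the
    -- difference of the radii.
    have h := mul_le_mul_of_nonneg_left (Real.cos_le_one (u.angle v))
      (mul_nonneg (s * u.zeta).coe_nonneg (t * v.zeta).coe_nonneg)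
    nlinarith [sq_nonneg (((s * u.zeta : ℝ≥0) : ℝ) - (t * v.zeta : ℝ≥0))]
  unfold TangentCone.prod
  rw [hzero, hzero, hdist]
  ring

/-- Products with unit directions are bounded below. -/
theorem TangentCone.exists_neg_le_prod_mk_one {p : H} (v : TangentCone p) :
    ∃ N : ℝ, 0 ≤ N ∧ ∀ u : Direction p, -N ≤ v.prod (TangentCone.mk 1 u) := by
  induction v using Quotient.inductionOn with
  | h x =>
    obtain ⟨s, w⟩ := x
    -- The bound is the norm of `v`; directions have norm at most 1, as in Cauchy–Schwarz.
    refine ⟨(s * w.zeta : ℝ≥0), NNReal.coe_nonneg _, fun u => ?_⟩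
    change _ ≤ (TangentCone.mk s w).prod (TangentCone.mk 1 u)
    rw [TangentCone.prod_mk, one_mul, mul_assoc]
    have h1 : |(u.zeta : ℝ) * Real.cos (w.angle u)| ≤ 1 := by
      rw [abs_mul, abs_of_nonneg u.zeta.coe_nonneg]
      exact mul_le_one₀ u.zeta_le_one (abs_nonneg _) (Real.abs_cos_le_one _)
    have h2 := mul_le_mul_of_nonneg_left (abs_le.1 h1).1 (s * w.zeta).coe_nonneg
    linarith

/-- The Alexandrov angle is at most the comparison angle. -/
theorem alexandrovAngle_le_comparisonAngle {p : H} (c₁ c₂ : GeodesicFrom p) (h1 : c₁.1 1 ≠ p)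
    (h2 : c₂.1 1 ≠ p) : alexandrovAngle c₁ c₂ ≤ comparisonAngle p (c₁.1 1) (c₂.1 1) := by
  refine le_of_tendsto (tendsto_alexandrovAngle c₁ c₂) ?_
  filter_upwards [eventually_prod_Ioc] with x hx
  exact comparisonAngle_mono c₁ c₂ h1 h2 hx.1.1 hx.1.2 le_rfl hx.2.1 hx.2.2 le_rfl

/-- The law of cosines as an inequality for `g_p`. -/
theorem TangentCone.le_prod_scaled (t : ℝ≥0) (p x q : H) :
    t * (dist p x ^ 2 + dist p q ^ 2 - dist x q ^ 2) ≤
      2 * dist p q * (TangentCone.scaled t p x).prod (TangentCone.mk 1 (Direction.to p q)) := by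
  unfold TangentCone.scaled
  rw [TangentCone.prod_mk]
  -- If `x = p` or `q = p`, both sides vanish, whatever the angle is.
  by_cases hx : x = p
  · subst hx; simp
  by_cases hq : q = p
  · subst hq; simp [dist_comm]
  rw [Direction.zeta_to hx, Direction.zeta_to hq]
  have hle : alexandrovAngle (geod p x) (geod p q) ≤ comparisonAngle p x q := by
    have := alexandrovAngle_le_comparisonAngle (geod p x) (geod p q)
      (by rwa [geod_one]) (by rwa [geod_one])
    rwa [geod_one, geod_one] at this
  -- Cosine reverses the angle comparison. The class of `γ_{p,q}` is a unit vector whatever the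
  -- speed, hence the factor `dist p q` in the statement.
  have hcos := Real.cos_le_cos_of_nonneg_of_le_pi (alexandrovAngle_mem (geod p x) (geod p q)).1
    (comparisonAngle_mem p x q).2 hle
  have h1 : 0 < dist p x := dist_pos.2 (Ne.symm hx)
  have h2 : 0 < dist p q := dist_pos.2 (Ne.symm hq)
  rw [cos_comparisonAngle hx hq, div_le_iff₀ (by positivity)] at hcos
  have h3 := mul_le_mul_of_nonneg_left hcos t.coe_nonneg
  push_cast
  refine h3.trans (le_of_eq ?_)
  change _ = 2 * dist p q * ((t : ℝ) * dist p x * 1 * (1 * 1) *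
    Real.cos (alexandrovAngle (geod p x) (geod p q)))
  ring

/-- The `CAT(0)` inequality for a point and a geodesic segment. -/
theorem dist_sq_geodesic_le {c : ℝ → H} (hc : IsNormalizedGeodesic c) (p : H) {t : ℝ}
    (ht : t ∈ Icc (0 : ℝ) 1) : dist (c t) p ^ 2 ≤
      (1 - t) * dist (c 0) p ^ 2 + t * dist (c 1) p ^ 2 - t * (1 - t) * dist (c 0) (c 1) ^ 2 := by
  let c₁ : GeodesicFrom (c 0) := ⟨c, hc, rfl⟩
  -- `cat0_two_sides` needs its first side to be nonconstant.
  by_cases h : c 1 = c 0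
  · have h0 : c t = c 0 := c₁.eq_base h ht
    rw [h0, h, dist_self]
    linarith
  · have key := cat0_two_sides c₁ (geod (c 0) p) (s := 1) (t := 1) (a := t) (b := 1)
      (by simp) (by simp) ht (by simp) h
    simp only [one_mul, geod_one, c₁] at key
    linarith

/-! ### Resolvents of a monotone vector field -/

namespace VectorField

variable {A : VectorField H}

theorem mem_dom_of_mem_resolvent {r : ℝ≥0} {z p : H} (hp : p ∈ A.resolvent r z) : p ∈ A.dom :=
  ⟨_, hp⟩

/-- Adding the cosine inequalities at `p` and at `q`, the distances to `x` cancel and `2 r⁻¹ dist p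
q ^ 2` remains on the left; monotonicity makes the right side nonpositive. -/
theorem Monotone.resolvent_subsingleton (hmono : A.Monotone) {r : ℝ≥0} (hr : 0 < r) {x p q : H}
    (hp : p ∈ A.resolvent r x) (hq : q ∈ A.resolvent r x) : p = q := by
  have h1 := TangentCone.le_prod_scaled r⁻¹ p x q
  have h2 := TangentCone.le_prod_scaled r⁻¹ q x p
  have h3 := mul_le_mul_of_nonneg_left (hmono p q _ hp _ hq)
    (mul_nonneg zero_le_two (dist_nonneg (x := p) (y := q)))
  rw [dist_comm q p, dist_comm q x] at h2
  rw [dist_comm p x] at h1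
  rw [dist_comm x p] at h1 h2
  have hr' : (0 : ℝ) < (r⁻¹ : ℝ≥0) := NNReal.coe_pos.2 (inv_pos.2 hr)
  have h4 : ((r⁻¹ : ℝ≥0) : ℝ) * dist p q ^ 2 ≤ 0 := by linarith
  have h5 : dist p q ^ 2 ≤ 0 := by
    by_contra hcon
    exact absurd h4 (not_le.2 (mul_pos hr' (not_le.1 hcon)))
  exact dist_eq_zero.1 (pow_eq_zero_iff two_ne_zero |>.1 (le_antisymm h5 (sq_nonneg _)))

/-- Resolvent points approach every point `w` of the domain, up to an error linear in `r`. -/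
theorem Monotone.exists_dist_resolvent_le (hmono : A.Monotone) {w : H} (hw : w ∈ A.dom) :
    ∃ N : ℝ, ∀ (r : ℝ≥0) (z p : H), 0 < r → p ∈ A.resolvent r z →
      dist p w ≤ dist z w + r * N := by
  obtain ⟨v, hv⟩ := hw
  obtain ⟨N, hN, hNle⟩ := v.exists_neg_le_prod_mk_one
  refine ⟨2 * N, fun r z p hr hp => ?_⟩
  have h1 := TangentCone.le_prod_scaled r⁻¹ p z w
  -- Monotonicity moves the product from the unknown point `p` to the fixed vector `v` at `w`, so
  -- the bound is uniform in `r`, `z` and `p`.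
  have h2 : (TangentCone.scaled r⁻¹ p z).prod (TangentCone.mk 1 (Direction.to p w)) ≤ N := by
    have := hmono p w _ hp _ hv
    linarith [hNle (Direction.to w p)]
  have hr' : (0 : ℝ) < r := NNReal.coe_pos.2 hr
  have h3 := mul_le_mul_of_nonneg_left (h1.trans
    (mul_le_mul_of_nonneg_left h2 (mul_nonneg zero_le_two dist_nonneg))) hr'.le
  rw [NNReal.coe_inv, mul_inv_cancel_left₀ hr'.ne'] at h3
  have h4 : 0 ≤ r * N := mul_nonneg hr'.le hN
  -- Dropping `dist p z ^ 2` leaves `dist p w ^ 2 - 2 r N dist p w ≤ dist z w ^ 2`. Completing the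
  -- square costs `r * N` on each side, hence the constant `2 * N`.
  have h5 : (dist p w - r * N) ^ 2 ≤ (dist z w + r * N) ^ 2 := by
    nlinarith [sq_nonneg (dist p z), mul_nonneg (dist_nonneg (x := z) (y := w)) h4]
  have h6 := abs_le_of_sq_le_sq h5 (add_nonneg dist_nonneg h4)
  linarith [le_of_abs_le h6]

/-- Replacing `x` by a nearby `w` in the domain costs `dist x w` twice, and the error linear in `r`
is the last third of `ε`. -/
theorem Monotone.eventually_dist_resolvent_lt (hmono : A.Monotone) {J : ℝ≥0 → H → H}
    (hJ : ∀ (r : ℝ≥0) (x : H), 0 < r → J r x ∈ A.resolvent r x) {x : H} (hx : x ∈ closure A.dom)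
    (z : H) {ε : ℝ} (hε : 0 < ε) : ∀ᶠ r in 𝓝[>] (0 : ℝ≥0), dist (J r z) x < dist z x + ε := by
  obtain ⟨w, hw, hxw⟩ := Metric.mem_closure_iff.1 hx (ε / 3) (by positivity)
  obtain ⟨N, hN⟩ := hmono.exists_dist_resolvent_le hw
  have hlim : Tendsto (fun r : ℝ≥0 => (r : ℝ) * N) (𝓝[>] 0) (𝓝 0) := by
    have : Continuous fun r : ℝ≥0 => (r : ℝ) * N := by fun_prop
    simpa using (this.tendsto 0).mono_left nhdsWithin_le_nhds
  filter_upwards [self_mem_nhdsWithin, hlim.eventually_lt_const (show 0 < ε / 3 by positivity)]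
    with r hr hrN
  have h1 := hN r z _ hr (hJ r z hr)
  have h2 := dist_triangle_right (J r z) x w
  have h3 := dist_triangle z x w
  linarith

end VectorField

end HadamardSpace

theorem proposition4p8 {H : Type*} [MetricSpace H] [CompleteSpace H] [HadamardSpace.CAT0Space H]
    (hext : HadamardSpace.GeodesicExtensionProperty H)
    (A : HadamardSpace.VectorField H) (hmono : A.Monotone) (hsurj : A.SurjectivityCondition) :
    HadamardSpace.GeodesicallyConvex (closure A.dom) ∧
    ∃ J : ℝ≥0 → H → H,
      (∀ (r : ℝ≥0) (x : H), 0 < r → A.resolvent r x = {J r x}) ∧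
      closure A.dom = {x : H | Tendsto (fun r : ℝ≥0 => J r x) (𝓝[>] 0) (𝓝 x)} := by
  -- The condition `0 < r` sits inside the existential so that `choose` yields a total `J`, with an
  -- arbitrary value at `r = 0`.
  have hex : ∀ (r : ℝ≥0) (x : H), ∃ p : H, 0 < r → p ∈ A.resolvent r x := by
    intro r x
    by_cases hr : 0 < r
    · obtain ⟨p, hp⟩ := hsurj r⁻¹ x (inv_pos.2 hr)
      exact ⟨p, fun _ => hp⟩
    · exact ⟨x, fun h => absurd h hr⟩
  choose J hJ using hex
  have hdom : ∀ x : H, ∀ᶠ r in 𝓝[>] (0 : ℝ≥0), J r x ∈ A.dom := fun x => by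
    filter_upwards [self_mem_nhdsWithin] with r hr
    exact HadamardSpace.VectorField.mem_dom_of_mem_resolvent (hJ r x hr)
  have hclosure : closure A.dom = {x : H | Tendsto (fun r : ℝ≥0 => J r x) (𝓝[>] 0) (𝓝 x)} := by
    ext x
    refine ⟨fun hx => Metric.tendsto_nhds.2 fun ε hε => ?_,
      fun hx => mem_closure_of_tendsto hx (hdom x)⟩
    simpa using hmono.eventually_dist_resolvent_lt hJ hx x hε
  refine ⟨fun c hc h0 h1 t ht => ?_, J, fun r x hr => ?_, hclosure⟩
  · set L := dist (c 0) (c 1) with hL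
    have hd0 : dist (c t) (c 0) = L * t := by
      rw [hc t ht 0 (by simp), sub_zero, abs_of_nonneg ht.1]
    have hd1 : dist (c t) (c 1) = L * (1 - t) := by
      rw [hc t ht 1 (by simp), abs_sub_comm, abs_of_nonneg (sub_nonneg.2 ht.2)]
    -- `f ε` bounds `dist (c t) p ^ 2` for any `p` within `L * t + ε` of `c 0` and `L * (1 - t) + ε`
    -- of `c 1`. It vanishes at `ε = 0` because the CAT(0) inequality is an equality for `p = c t`.
    set f : ℝ → ℝ := fun ε => (1 - t) * (L * t + ε) ^ 2 + t * (L * (1 - t) + ε) ^ 2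
      - t * (1 - t) * L ^ 2 with hf
    have hlim : Tendsto f (𝓝[>] 0) (𝓝 0) := by
      have hcont : Continuous f := by fun_prop
      have hf0 : f 0 = 0 := by simp only [hf]; ring
      simpa only [hf0] using (hcont.tendsto 0).mono_left nhdsWithin_le_nhds
    refine Metric.mem_closure_iff.2 fun δ hδ => ?_
    obtain ⟨ε, hεδ, hε⟩ := ((hlim.eventually_lt_const (show 0 < δ ^ 2 by positivity)).and
      self_mem_nhdsWithin).exists
    -- For small `r` the point `J r (c t)` lies in the domain and is almost as close to both
    -- endpoints as `c t`, so it is the required approximation.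
    obtain ⟨r, hr0, hr1, hr⟩ := ((hmono.eventually_dist_resolvent_lt hJ h0 (c t) hε).and
      ((hmono.eventually_dist_resolvent_lt hJ h1 (c t) hε).and (hdom (c t)))).exists
    refine ⟨J r (c t), hr, lt_of_pow_lt_pow_left₀ 2 hδ.le (lt_of_le_of_lt ?_ hεδ)⟩
    rw [hd0, dist_comm] at hr0
    rw [hd1, dist_comm] at hr1
    refine (HadamardSpace.dist_sq_geodesic_le hc (J r (c t)) ht).trans ?_
    have e0 := mul_le_mul_of_nonneg_left (pow_le_pow_left₀ dist_nonneg hr0.le 2)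
      (sub_nonneg.2 ht.2)
    have e1 := mul_le_mul_of_nonneg_left (pow_le_pow_left₀ dist_nonneg hr1.le 2) ht.1
    simp only [hf]
    linarith
  · exact Set.Subset.antisymm
      (fun p hp => hmono.resolvent_subsingleton hr hp (hJ r x hr))
      (Set.singleton_subset_iff.2 (hJ r x hr))
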